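/- For an integer $d\ge 1$, a $d$-dimensional 0-1 matrix is an array $P$ of side lengths $k_1\times\dots\times k_d$ with entries in $\{0,1\}$. A $d$-dimensional 0-1 matrix $A$ contains $P$ if some submatrix of $A$ (obtained by selecting, in each dimension $i$, $k_i$ of the indices and keeping their order) can be turned into $P$ by changing some number (possibly none) of ones to zeroes; otherwise $A$ avoids $P$. Let $\mathrm{ex}(n,P,d)$ be the maximum number of ones in a $d$-dimensional 0-1 matrix of side lengths $n\times\dots\times n$ that avoids $P$ (and $0$ if no such matrix exists, which can happen only if $P$ has no ones). For an integer $t\ge 1$, let $Q_{P,t}$ be the $(d+1)$-dimensional 0-1 matrix of side lengths $k_1\times\dots\times k_d\times t$ obtained by stacking $t$ copies of $P$ with the same orientation in the direction of a new dimension, that is, $Q_{P,t}(x_1,\dots,x_d,j)=P(x_1,\dots,x_d)$. **Theorem.** Fix $d\ge 1$ and a $d$-dimensional 0-1 matrix $P$. All asymptotics are for $n\to\infty$, and the implied constants may depend on $d$, $P$ and $t$. 1. If $P$ has at least two ones, then for every fixed $t\ge 1$, $$\mathrm{ex}(n,Q_{P,t},d+1)=O\!\left(\mathrm{ex}(n,P,d)^{1/t}\,n^{d+1-d/t}\right).$$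 2. Suppose that $\mathrm{ex}(n,P,d)=O(n^{d-1})$. Then: - for every fixed $t\ge 1$, $\mathrm{ex}(n,Q_{P,t},d+1)=O(n^{d+1-1/t})$; - if $P$ has at least two ones, then $\mathrm{ex}(n,Q_{P,2},d+1)=\Theta(n^{d+1/2})$; - if $P$ has three ones whose first coordinates are pairwise distinct, then $\mathrm{ex}(n,Q_{P,3},d+1)=\Theta(n^{d+2/3})$. -/

import Mathlib

open Filter Asymptotics

/-- A `d`-dimensional 0-1 matrix whose side lengths are `k 0, …, k (d - 1)`. -/
abbrev ZeroOneMatrix {d : ℕ} (k : Fin d → ℕ) : Type := (∀ i, Fin (k i)) → Fin 2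

namespace ZeroOneMatrix

/-- The number of ones of a 0-1 matrix. -/
def ones {d : ℕ} {k : Fin d → ℕ} (A : ZeroOneMatrix k) : ℕ :=
  (Finset.univ.filter fun x => A x = 1).card

/-- The submatrix of `A` obtained by selecting, in each dimension `i`, the `k i` slices that are
listed in increasing order by `f i`. -/
def submatrix {d : ℕ} {m k : Fin d → ℕ} (A : ZeroOneMatrix m) (f : ∀ i, Fin (k i) ↪o Fin (m i)) :
    ZeroOneMatrix k :=
  fun x => A fun i => f i (x i)

/-- `A` contains `B`: some submatrix of `A` has the shape of `B` and can be turned into `B` by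
changing some number (possibly none) of its ones to zeroes. -/
def Contains {d : ℕ} {m k : Fin d → ℕ} (A : ZeroOneMatrix m) (B : ZeroOneMatrix k) : Prop :=
  ∃ f : ∀ i, Fin (k i) ↪o Fin (m i), ∀ x, B x = 1 → A.submatrix f x = 1

/-- `ex n P` is the maximum number of ones in a 0-1 matrix of side length `n`, of the same dimension
as `P`, that avoids `P`. The set below is finite; it is empty only if `P` has no ones
(and `n` is large), and then `ex n P = 0`. -/
noncomputable def ex {d : ℕ} {k : Fin d → ℕ} (n : ℕ) (P : ZeroOneMatrix k) : ℕ :=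
  sSup {m : ℕ | ∃ A : ZeroOneMatrix (fun _ : Fin d => n), ¬ A.Contains P ∧ A.ones = m}

/-- The `(d + 1)`-dimensional 0-1 matrix obtained from the `d`-dimensional matrix `P` by stacking
`t` copies of `P` in the direction of a new, last dimension. -/
def stack {d : ℕ} {k : Fin d → ℕ} (P : ZeroOneMatrix k) (t : ℕ) :
    ZeroOneMatrix (Fin.snoc (α := fun _ => ℕ) k t) :=
  fun x => P fun i => Fin.cast (Fin.snoc_castSucc (α := fun _ => ℕ) t k i) (x i.castSucc)

end ZeroOneMatrix

/-! The upper bounds are a Kővári–Sós–Turán double count. For a fixed `t`-set `T` of heights, the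
base points whose column contains `T` form a `d`-dimensional matrix avoiding `P`, as a copy of `P`
there lifts to `P.stack t`. Counting pairs (base point, `T`) bounds the sum of binomials of the
column sizes (`sum_choose_column_le`); the power mean inequality turns this into a bound on the
number of ones (`ex_stack_le`).

The lower bounds come from dense `K_{s,s}`-free bipartite graphs: point-line incidences for `s = 2`,
projective norm graphs for `s = 3`. Imposing such a graph on one old coordinate and the new one,
with all other coordinates free, avoids `P.stack s` as soon as `P` has `s` ones distinct in that old
coordinate (`mul_card_le_ex_stack`). Bertrand's postulate passes from prime powers to all `n`. -/

/-- A relation is `K_{s,s}`-free if it has no `s` rows and `s` columns that are all related. -/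
def BicliqueFree (s : ℕ) {V W : Type*} (R : V → W → Prop) : Prop :=
  ∀ (f : Fin s → V) (g : Fin s → W), Function.Injective f → Function.Injective g →
    ¬ ∀ i j, R (f i) (g j)

/-- Two circles with distinct centers meet in at most two points. -/
theorem circles_inter_card_le_two {K : Type*} [Field K] (σ : K →+* K) {A B c e x y z : K}
    (hAB : A ≠ B) (hx : (x + A) * σ (x + A) = c) (hx' : (x + B) * σ (x + B) = e)
    (hy : (y + A) * σ (y + A) = c) (hy' : (y + B) * σ (y + B) = e)
    (hz : (z + A) * σ (z + A) = c) (hz' : (z + B) * σ (z + B) = e)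
    (hxy : x ≠ y) (hxz : x ≠ z) : y = z := by
  have hD : A - B ≠ 0 := sub_ne_zero.2 hAB
  have hD' : σ A - σ B ≠ 0 := by rwa [← map_sub, Ne, map_eq_zero]
  simp only [map_add] at *
  -- Subtracting the two circle equations leaves a relation linear in `w` and `σ w`; eliminating `σ
  -- w` with it determines `w` from `x`.
  have key : ∀ w, x ≠ w → (w + A) * (σ w + σ A) = c → (w + B) * (σ w + σ B) = e →
      (σ A - σ B) * (w + A) = (A - B) * (σ x + σ A) := by
    intro w hw h1 h2
    have hl : (A - B) * (σ w - σ x) + (σ A - σ B) * (w - x) = 0 := by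
      linear_combination h1 - h2 - hx + hx'
    refine mul_left_cancel₀ (sub_ne_zero.2 hw) ?_
    linear_combination (A - B) * (h1 - hx) - (w + A) * hl
  have := (key y hxy hy hy').trans (key z hxz hz hz').symm
  exact add_right_cancel (mul_left_cancel₀ hD' this)

/-- Dividing the equations for `i = 0, 1` by the one for `i = 2` and inverting `X 2 + Y j` puts
three distinct points on two circles with distinct centers. -/
theorem not_biclique_three_of_norm {K : Type*} [Field K] (σ : K →+* K) (X Y a b : Fin 3 → K)
    (hX : Function.Injective fun i => (X i, a i)) (hY : Function.Injective fun i => (Y i, b i))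
    (ha : ∀ i, a i ≠ 0) (hb : ∀ i, b i ≠ 0)
    (h : ∀ i j, (X i + Y j) * σ (X i + Y j) = a i * b j) : False := by
  have hX' : Function.Injective X := by
    intro i j hij
    apply hX
    have := h i 0
    rw [hij, h j 0] at this
    exact Prod.ext hij (mul_right_cancel₀ (hb 0) this).symm
  have hY' : Function.Injective Y := by
    intro i j hij
    apply hY
    have := h 0 i
    rw [hij, h 0 j] at this
    exact Prod.ext hij (mul_left_cancel₀ (ha 0) this).symm
  have hne : ∀ i j, X i + Y j ≠ 0 := by
    intro i j h0
    have := h i j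
    rw [h0, zero_mul] at this
    exact mul_ne_zero (ha i) (hb j) this.symm
  have key : ∀ i j, i ≠ 2 →
      ((X 2 + Y j)⁻¹ + (X i - X 2)⁻¹) * σ ((X 2 + Y j)⁻¹ + (X i - X 2)⁻¹) =
        a i / a 2 * ((X i - X 2)⁻¹ * σ (X i - X 2)⁻¹) := by
    intro i j hi
    have hd : X i - X 2 ≠ 0 := sub_ne_zero.2 fun e => hi (hX' e)
    have h1 : (X 2 + Y j)⁻¹ + (X i - X 2)⁻¹ = (X i + Y j) * (X 2 + Y j)⁻¹ * (X i - X 2)⁻¹ := by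
      have := hne 2 j
      field_simp
      ring
    have h2 : (X 2 + Y j)⁻¹ * σ (X 2 + Y j)⁻¹ = (a 2 * b j)⁻¹ := by
      rw [map_inv₀, ← mul_inv, h]
    rw [h1, map_mul, map_mul]
    calc _ = ((X i + Y j) * σ (X i + Y j)) * ((X 2 + Y j)⁻¹ * σ (X 2 + Y j)⁻¹) *
          ((X i - X 2)⁻¹ * σ (X i - X 2)⁻¹) := by ring
      _ = _ := by
        rw [h, h2]
        have := ha 2
        have := hb j
        congr 1
        field_simp
  have hinj : ∀ i j, i ≠ j → (X 2 + Y i)⁻¹ ≠ (X 2 + Y j)⁻¹ := by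
    intro i j hij he
    exact hij (hY' (add_left_cancel (inv_injective he)))
  have hA : (X 0 - X 2)⁻¹ ≠ (X 1 - X 2)⁻¹ := by
    intro he
    exact absurd (hX' (sub_left_injective (inv_injective he))) (by decide)
  exact hinj 1 2 (by decide) (circles_inter_card_le_two σ hA
    (key 0 0 (by decide)) (key 1 0 (by decide)) (key 0 1 (by decide)) (key 1 1 (by decide))
    (key 0 2 (by decide)) (key 1 2 (by decide)) (hinj 0 1 (by decide)) (hinj 0 2 (by decide)))

/-- The projective norm graph over the field with `p ^ 2` elements. -/
def normGraph (p : ℕ) [Fact p.Prime] (v w : GaloisField p 2 × (ZMod p)ˣ) : Prop :=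
  Algebra.norm (ZMod p) (v.1 + w.1) = v.2 * w.2

theorem normGraph_bicliqueFree (p : ℕ) [Fact p.Prime] : BicliqueFree 3 (normGraph p) := by
  intro f g hf hg h
  have hφ := (algebraMap (ZMod p) (GaloisField p 2)).injective
  have hinj : Function.Injective fun v : GaloisField p 2 × (ZMod p)ˣ =>
      (v.1, algebraMap (ZMod p) (GaloisField p 2) v.2) := by
    intro v w hvw
    rw [Prod.mk.injEq] at hvw
    exact Prod.ext hvw.1 (Units.ext (hφ hvw.2))
  have hnz : ∀ u : (ZMod p)ˣ, algebraMap (ZMod p) (GaloisField p 2) u ≠ 0 := fun u => by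
    simp
  refine not_biclique_three_of_norm (frobenius (GaloisField p 2) p) (fun i => (f i).1)
    (fun i => (g i).1) (fun i => algebraMap _ _ ((f i).2 : ZMod p))
    (fun i => algebraMap _ _ ((g i).2 : ZMod p)) (hinj.comp hf) (hinj.comp hg)
    (fun i => hnz _) (fun i => hnz _) fun i j => ?_
  have := congrArg (algebraMap (ZMod p) (GaloisField p 2)) (h i j)
  rw [FiniteField.algebraMap_norm_eq_pow_sum, GaloisField.finrank p two_ne_zero, map_mul] at this
  rw [← this, frobenius_def]
  simp [Finset.sum_range_succ, pow_add]

/-- The incidence relation between points and non-vertical lines of the affine plane. -/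
def lineGraph (F : Type*) [Field F] (v w : F × F) : Prop := v.2 + w.2 = v.1 * w.1

theorem lineGraph_bicliqueFree (F : Type*) [Field F] : BicliqueFree 2 (lineGraph F) := by
  intro f g hf hg h
  simp only [lineGraph] at h
  have hf' : (f 0).1 ≠ (f 1).1 := by
    intro he
    have : f 0 = f 1 := Prod.ext he (by linear_combination h 0 0 - h 1 0 + (g 0).1 * he)
    exact absurd (hf this) (by decide)
  have hg' : (g 0).1 ≠ (g 1).1 := by
    intro he
    have : g 0 = g 1 := Prod.ext he (by linear_combination h 0 0 - h 0 1 + (f 0).1 * he)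
    exact absurd (hg this) (by decide)
  have : ((f 0).1 - (f 1).1) * ((g 0).1 - (g 1).1) = 0 := by
    linear_combination h 0 1 - h 0 0 + h 1 0 - h 1 1
  exact (mul_ne_zero (sub_ne_zero.2 hf') (sub_ne_zero.2 hg')) this

/-! ### Dense biclique-free relations on `Fin n` for every large `n` -/

/-- A finite relation embeds into a relation on `Fin n`. -/
theorem BicliqueFree.exists_finset {s : ℕ} {V W ι : Type*} [Fintype V] [Fintype W] [Fintype ι]
    {R : V → W → Prop} (hR : BicliqueFree s R) {n : ℕ} (hV : Fintype.card V ≤ n)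
    (hW : Fintype.card W ≤ n) (e : ι → V × W) (he : Function.Injective e)
    (hι : ∀ i, R (e i).1 (e i).2) :
    ∃ E : Finset (Fin n × Fin n), E.card = Fintype.card ι ∧
      BicliqueFree s fun a b => (a, b) ∈ E := by
  classical
  obtain ⟨φ⟩ : Nonempty (V ↪ Fin n) := Function.Embedding.nonempty_of_card_le (by simpa)
  obtain ⟨ψ⟩ : Nonempty (W ↪ Fin n) := Function.Embedding.nonempty_of_card_le (by simpa)
  refine ⟨Finset.univ.map ⟨fun i => (φ (e i).1, ψ (e i).2), ?_⟩, by simp, ?_⟩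
  · intro i j hij
    rw [Prod.mk.injEq] at hij
    exact he (Prod.ext (φ.injective hij.1) (ψ.injective hij.2))
  · intro f g hf hg h
    have h' : ∀ i j, ∃ v w, R v w ∧ φ v = f i ∧ ψ w = g j := by
      intro i j
      have := h i j
      simp only [Finset.mem_map, Finset.mem_univ, true_and] at this
      obtain ⟨k, hk⟩ := this
      exact ⟨_, _, hι k, congrArg Prod.fst hk, congrArg Prod.snd hk⟩
    choose v w hR' hv hw using h'
    rcases Nat.eq_zero_or_pos s with rfl | hs
    · exact hR Fin.elim0 Fin.elim0 (fun i => i.elim0) (fun i => i.elim0) fun i => i.elim0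
    -- The chosen preimages depend on both indices only formally, by injectivity of `φ` and `ψ`.
    · refine hR (fun i => v i ⟨0, hs⟩) (fun j => w ⟨0, hs⟩ j) ?_ ?_ fun i j => ?_
      · exact Function.Injective.of_comp (f := φ) (by simpa [Function.comp_def, hv] using hf)
      · exact Function.Injective.of_comp (f := ψ) (by simpa [Function.comp_def, hw] using hg)
      · have h1 : v i ⟨0, hs⟩ = v i j := φ.injective ((hv _ _).trans (hv _ _).symm)
        have h2 : w ⟨0, hs⟩ j = w i j := ψ.injective ((hw _ _).trans (hw _ _).symm)
        rw [h1, h2]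
        exact hR' i j

theorem exists_bicliqueFree_two_of_prime {p n : ℕ} (hp : p.Prime) (hn : p ^ 2 ≤ n) :
    ∃ E : Finset (Fin n × Fin n), E.card = p ^ 3 ∧ BicliqueFree 2 fun a b => (a, b) ∈ E := by
  have := Fact.mk hp
  have hc : Fintype.card (ZMod p × ZMod p) ≤ n := by simpa [ZMod.card, ← sq] using hn
  obtain ⟨E, hE, h⟩ := (lineGraph_bicliqueFree (ZMod p)).exists_finset hc hc
    (fun i : ZMod p × ZMod p × ZMod p => ((i.1, i.2.1), (i.2.2, i.1 * i.2.2 - i.2.1)))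
    (by rintro ⟨a, b, c⟩ ⟨a', b', c'⟩ h; simp_all) (by simp [lineGraph])
  refine ⟨E, ?_, h⟩
  rw [hE]
  simp [ZMod.card]
  ring

theorem exists_bicliqueFree_three_of_prime {p n : ℕ} (hp : p.Prime) (hn : p ^ 3 ≤ n) :
    ∃ E : Finset (Fin n × Fin n), E.card = p ^ 2 * (p - 1) * (p ^ 2 - 1) ∧
      BicliqueFree 3 fun a b => (a, b) ∈ E := by
  classical
  have := Fact.mk hp
  have := Fintype.ofFinite (GaloisField p 2)
  have hK : Fintype.card (GaloisField p 2) = p ^ 2 := by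
    rw [← Nat.card_eq_fintype_card, GaloisField.card p 2 two_ne_zero]
  have hc : Fintype.card (GaloisField p 2 × (ZMod p)ˣ) ≤ n := by
    rw [Fintype.card_prod, hK, ZMod.card_units]
    calc p ^ 2 * (p - 1) ≤ p ^ 2 * p := Nat.mul_le_mul_left _ (Nat.sub_le _ _)
      _ ≤ n := by rwa [← pow_succ]
  let N : (GaloisField p 2)ˣ →* (ZMod p)ˣ := Units.map (Algebra.norm (ZMod p))
  obtain ⟨E, hE, h⟩ := (normGraph_bicliqueFree p).exists_finset hc hc
    (fun i : (GaloisField p 2 × (ZMod p)ˣ) × (GaloisField p 2)ˣ =>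
      (i.1, ((i.2 : GaloisField p 2) - i.1.1, i.1.2⁻¹ * N i.2)))
    (by
      rintro ⟨⟨a, b⟩, c⟩ ⟨⟨a', b'⟩, c'⟩ h
      simp only [Prod.mk.injEq] at h ⊢
      obtain ⟨⟨rfl, rfl⟩, h, -⟩ := h
      exact ⟨⟨rfl, rfl⟩, Units.ext (sub_left_injective h)⟩)
    (by
      rintro ⟨⟨a, b⟩, c⟩
      rw [normGraph, add_sub_cancel, ← Units.val_mul, mul_inv_cancel_left]
      rfl)
  refine ⟨E, ?_, h⟩
  rw [hE, Fintype.card_prod, Fintype.card_prod, hK, ZMod.card_units, Fintype.card_units, hK]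

/-- Primes are dense enough that some `r`-th power of a prime is within a constant of `n`. -/
theorem exists_prime_pow_le (r : ℕ) (hr : r ≠ 0) {n : ℕ} (hn : 2 ^ r ≤ n) :
    ∃ p : ℕ, p.Prime ∧ p ^ r ≤ n ∧ n ≤ 4 ^ r * p ^ r := by
  set P : ℕ → Prop := fun m => (2 * m) ^ r ≤ n
  have hb : ∀ m, P m → m ≤ n := fun m hm =>
    (by omega : m ≤ 2 * m).trans ((Nat.le_self_pow hr _).trans hm)
  have h1 : P 1 := by simpa [P] using hn
  have hg : P (Nat.findGreatest P n) := Nat.findGreatest_spec (hb 1 h1) h1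
  have hm1 : 1 ≤ Nat.findGreatest P n := Nat.le_findGreatest (hb 1 h1) h1
  set m := Nat.findGreatest P n with hm
  have hlt : ¬ P (m + 1) := fun h => by
    have := Nat.le_findGreatest (hb _ h) h
    omega
  obtain ⟨p, hp, hmp, hpm⟩ := Nat.exists_prime_lt_and_le_two_mul m (by omega)
  refine ⟨p, hp, (Nat.pow_le_pow_left hpm r).trans hg, ?_⟩
  rw [← mul_pow]
  exact (not_le.1 hlt).le.trans (Nat.pow_le_pow_left (by omega) r)

theorem exists_bicliqueFree_two {n : ℕ} (hn : 4 ≤ n) :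
    ∃ E : Finset (Fin n × Fin n), (n : ℝ) ^ (3 / 2 : ℝ) ≤ 64 * E.card ∧
      BicliqueFree 2 fun a b => (a, b) ∈ E := by
  obtain ⟨p, hp, h1, h2⟩ := exists_prime_pow_le 2 two_ne_zero hn
  obtain ⟨E, hE, h⟩ := exists_bicliqueFree_two_of_prime hp h1
  refine ⟨E, ?_, h⟩
  have h3 : (n : ℝ) ≤ ((4 * p : ℕ) : ℝ) ^ (2 : ℝ) := by
    rw [← mul_pow] at h2
    exact_mod_cast h2
  calc (n : ℝ) ^ (3 / 2 : ℝ) ≤ (((4 * p : ℕ) : ℝ) ^ (2 : ℝ)) ^ (3 / 2 : ℝ) := by gcongr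
    _ = ((4 * p : ℕ) : ℝ) ^ (3 : ℝ) := by
      rw [← Real.rpow_mul (by positivity)]
      norm_num
    _ = 64 * E.card := by
      rw [hE, show (3 : ℝ) = (3 : ℕ) by norm_num, Real.rpow_natCast]
      push_cast
      ring

theorem exists_bicliqueFree_three {n : ℕ} (hn : 8 ≤ n) :
    ∃ E : Finset (Fin n × Fin n), (n : ℝ) ^ (5 / 3 : ℝ) ≤ 4096 * E.card ∧
      BicliqueFree 3 fun a b => (a, b) ∈ E := by
  obtain ⟨p, hp, h1, h2⟩ := exists_prime_pow_le 3 three_ne_zero hn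
  obtain ⟨E, hE, h⟩ := exists_bicliqueFree_three_of_prime hp h1
  refine ⟨E, ?_, h⟩
  have h3 : (n : ℝ) ≤ ((4 * p : ℕ) : ℝ) ^ (3 : ℝ) := by
    rw [← mul_pow] at h2
    exact_mod_cast h2
  have hp2 := hp.two_le
  -- Each of `p - 1` and `p ^ 2 - 1` costs a factor 2; with `4 ^ 5` from the choice of `p` this
  -- gives 4096.
  have h5 : p ^ 5 ≤ 4 * E.card := by
    have ha : p ≤ 2 * (p - 1) := by omega
    have hb : p ^ 2 ≤ 2 * (p ^ 2 - 1) := by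
      have : 2 ^ 2 ≤ p ^ 2 := Nat.pow_le_pow_left hp2 2
      omega
    calc p ^ 5 = p ^ 2 * p * p ^ 2 := by ring
      _ ≤ p ^ 2 * (2 * (p - 1)) * (2 * (p ^ 2 - 1)) := by gcongr
      _ = 4 * E.card := by rw [hE]; ring
  calc (n : ℝ) ^ (5 / 3 : ℝ) ≤ (((4 * p : ℕ) : ℝ) ^ (3 : ℝ)) ^ (5 / 3 : ℝ) := by gcongr
    _ = ((4 * p : ℕ) : ℝ) ^ (5 : ℝ) := by
      rw [← Real.rpow_mul (by positivity)]
      norm_num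
    _ = 1024 * (p ^ 5 : ℕ) := by
      rw [show (5 : ℝ) = (5 : ℕ) by norm_num, Real.rpow_natCast]
      push_cast
      ring
    _ ≤ 1024 * (4 * E.card : ℕ) := by gcongr
    _ = 4096 * E.card := by push_cast; ring

theorem injective_fin_two {α : Type*} {f : Fin 2 → α} (h : f 0 ≠ f 1) : Function.Injective f
  | 0, 0, _ => rfl
  | 0, 1, e => absurd e h
  | 1, 0, e => absurd e.symm h
  | 1, 1, _ => rfl

theorem injective_fin_three {α : Type*} {f : Fin 3 → α} (h : f 0 ≠ f 1) (h' : f 0 ≠ f 2)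
    (h'' : f 1 ≠ f 2) : Function.Injective f
  | 0, 0, _ => rfl
  | 0, 1, e => absurd e h
  | 0, 2, e => absurd e h'
  | 1, 0, e => absurd e.symm h
  | 1, 1, _ => rfl
  | 1, 2, e => absurd e h''
  | 2, 0, e => absurd e.symm h'
  | 2, 1, e => absurd e.symm h''
  | 2, 2, _ => rfl

/-! ### Upper bound by double counting -/

namespace ZeroOneMatrix

theorem bddAbove_ones {d : ℕ} {k : Fin d → ℕ} (n : ℕ) (P : ZeroOneMatrix k) :
    BddAbove {m : ℕ | ∃ A : ZeroOneMatrix (fun _ : Fin d => n), ¬ A.Contains P ∧ A.ones = m} := by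
  refine ⟨Fintype.card (Fin d → Fin n), ?_⟩
  rintro _ ⟨A, -, rfl⟩
  exact Finset.card_le_univ _

theorem ones_le_ex {d : ℕ} {k : Fin d → ℕ} {n : ℕ} {P : ZeroOneMatrix k}
    {A : ZeroOneMatrix (fun _ : Fin d => n)} (hA : ¬ A.Contains P) : A.ones ≤ P.ex n :=
  le_csSup (bddAbove_ones n P) ⟨A, hA, rfl⟩

theorem ex_le_of_forall {d : ℕ} {k : Fin d → ℕ} {n : ℕ} {P : ZeroOneMatrix k} {C : ℝ} (hC : 0 ≤ C)
    (h : ∀ A : ZeroOneMatrix (fun _ : Fin d => n), ¬ A.Contains P → (A.ones : ℝ) ≤ C) :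
    (P.ex n : ℝ) ≤ C := by
  -- In `ℕ` the empty supremum is 0, so no avoiding matrix need exist.
  refine (Nat.le_floor_iff hC).1 (csSup_le' ?_)
  rintro _ ⟨A, hA, rfl⟩
  exact Nat.le_floor (h A hA)

open Classical in
/-- The 0-1 matrix whose ones are the indices satisfying `p`. -/
noncomputable def ofPred {d : ℕ} {k : Fin d → ℕ} (p : (∀ i, Fin (k i)) → Prop) :
    ZeroOneMatrix k :=
  fun x => if p x then 1 else 0

@[simp]
theorem ofPred_eq_one {d : ℕ} {k : Fin d → ℕ} {p : (∀ i, Fin (k i)) → Prop} {x : ∀ i, Fin (k i)} :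
    ofPred p x = 1 ↔ p x := by
  by_cases h : p x <;> simp [ofPred, h]

/-- The positions in the new dimension where the line of `A` through `x` has ones. -/
def column {d n : ℕ} (A : ZeroOneMatrix (fun _ : Fin (d + 1) => n)) (x : Fin d → Fin n) :
    Finset (Fin n) :=
  Finset.univ.filter fun j => A (Fin.snoc (α := fun _ => Fin n) x j) = 1

theorem sum_card_column {d n : ℕ} (A : ZeroOneMatrix (fun _ : Fin (d + 1) => n)) :
    ∑ x, (A.column x).card = A.ones := by
  classical
  rw [ones, ← Finset.card_sigma]
  refine Finset.card_bij' (fun p _ => Fin.snoc (α := fun _ => Fin n) p.1 p.2)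
    (fun z _ => ⟨Fin.init z, z (Fin.last d)⟩) ?_ ?_ ?_ ?_
  · rintro ⟨x, j⟩ h
    simpa [column] using h
  · intro z h
    simpa [column] using h
  · rintro ⟨x, j⟩ h
    simp
  · intro z h
    simp

/-- A set of `t` positions common to the columns over a copy of `P` yields a copy of
`P.stack t`. -/
theorem contains_stack {d n : ℕ} {k : Fin d → ℕ} {P : ZeroOneMatrix k} {t : ℕ}
    {A : ZeroOneMatrix (fun _ : Fin (d + 1) => n)} {T : Finset (Fin n)} (hT : T.card = t)
    (h : (ofPred (k := fun _ : Fin d => n) fun x => T ⊆ A.column x).Contains P) :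
    A.Contains (P.stack t) := by
  obtain ⟨f, hf⟩ := h
  refine ⟨Fin.lastCases
    ((Fin.castOrderIso (Fin.snoc_last (α := fun _ => ℕ) t k)).toOrderEmbedding.trans
      (T.orderEmbOfFin hT))
    fun i => (Fin.castOrderIso (Fin.snoc_castSucc (α := fun _ => ℕ) t k i)).toOrderEmbedding.trans
      (f i), fun x hx => ?_⟩
  have h1 := hf _ hx
  rw [submatrix, ofPred_eq_one] at h1
  have h2 := h1 (T.orderEmbOfFin_mem hT
    (Fin.cast (Fin.snoc_last (α := fun _ => ℕ) t k) (x (Fin.last d))))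
  simp only [column, Finset.mem_filter, Finset.mem_univ, true_and] at h2
  rw [submatrix, ← h2]
  congr 1
  funext i
  refine Fin.lastCases ?_ (fun i => ?_) i
  · simp
  · simp

theorem sum_choose_column_le {d n : ℕ} {k : Fin d → ℕ} {P : ZeroOneMatrix k} {t : ℕ}
    {A : ZeroOneMatrix (fun _ : Fin (d + 1) => n)} (hA : ¬ A.Contains (P.stack t)) :
    ∑ x, (A.column x).card.choose t ≤ n.choose t * P.ex n := by
  classical
  calc ∑ x, (A.column x).card.choose t
      = ∑ x, ((Finset.univ.powersetCard t).bipartiteAbove (fun x T => T ⊆ A.column x) x).card := by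
        refine Finset.sum_congr rfl fun x _ => ?_
        rw [← Finset.card_powersetCard]
        congr 1
        ext T
        simp [Finset.bipartiteAbove, Finset.mem_powersetCard, and_comm]
    _ = ∑ T ∈ Finset.univ.powersetCard t,
          (Finset.univ.bipartiteBelow (fun x T => T ⊆ A.column x) T).card :=
        Finset.sum_card_bipartiteAbove_eq_sum_card_bipartiteBelow _
    _ ≤ ∑ T ∈ (Finset.univ : Finset (Fin n)).powersetCard t, P.ex n := by
        refine Finset.sum_le_sum fun T hT => ?_
        have := ones_le_ex fun h => hA (contains_stack (Finset.mem_powersetCard.1 hT).2 h)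
        simpa [ones, Finset.bipartiteBelow] using this
    _ = n.choose t * P.ex n := by simp

theorem sum_column_pow_le {d n : ℕ} {k : Fin d → ℕ} {P : ZeroOneMatrix k} {t : ℕ}
    {A : ZeroOneMatrix (fun _ : Fin (d + 1) => n)} (hA : ¬ A.Contains (P.stack t)) :
    ∑ x, ((A.column x).card + 1 - t) ^ t ≤ n ^ t * P.ex n :=
  calc ∑ x, ((A.column x).card + 1 - t) ^ t
      ≤ ∑ x, t.factorial * (A.column x).card.choose t := by
        refine Finset.sum_le_sum fun x _ => ?_
        rw [← Nat.descFactorial_eq_factorial_mul_choose]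
        exact Nat.pow_sub_le_descFactorial _ _
    _ = t.factorial * ∑ x, (A.column x).card.choose t := by rw [Finset.mul_sum]
    _ ≤ t.factorial * (n.choose t * P.ex n) := Nat.mul_le_mul_left _ (sum_choose_column_le hA)
    _ = n.descFactorial t * P.ex n := by
        rw [Nat.descFactorial_eq_factorial_mul_choose, mul_assoc]
    _ ≤ n ^ t * P.ex n := Nat.mul_le_mul_right _ (Nat.descFactorial_le_pow _ _)

theorem sum_column_sub_pow_le {d n : ℕ} {k : Fin d → ℕ} {P : ZeroOneMatrix k} {t : ℕ} (ht : 1 ≤ t)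
    {A : ZeroOneMatrix (fun _ : Fin (d + 1) => n)} (hA : ¬ A.Contains (P.stack t)) :
    (∑ x, ((A.column x).card + 1 - t)) ^ t ≤ (n ^ d) ^ (t - 1) * (n ^ t * P.ex n) := by
  obtain ⟨s, rfl⟩ := Nat.exists_eq_add_of_le' ht
  calc _ ≤ _ := pow_sum_le_card_mul_sum_pow (fun _ _ => Nat.zero_le _) s
    _ ≤ _ := Nat.mul_le_mul_left _ (sum_column_pow_le hA)
    _ = _ := by simp

theorem ones_le_of_not_contains_stack {d n : ℕ} (hn : 0 < n) {k : Fin d → ℕ} {P : ZeroOneMatrix k}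
    {t : ℕ} (ht : 1 ≤ t) {A : ZeroOneMatrix (fun _ : Fin (d + 1) => n)}
    (hA : ¬ A.Contains (P.stack t)) :
    (A.ones : ℝ) ≤ (P.ex n : ℝ) ^ (1 / (t : ℝ)) * (n : ℝ) ^ ((d : ℝ) + 1 - (d : ℝ) / (t : ℝ)) +
      t * (n : ℝ) ^ (d : ℝ) := by
  -- Truncated subtraction loses at most `t` ones in each of the `n ^ d` columns.
  have h1 : A.ones ≤ ∑ x, ((A.column x).card + 1 - t) + t * n ^ d := by
    rw [← sum_card_column]
    calc ∑ x, (A.column x).card ≤ ∑ x, ((A.column x).card + 1 - t + t) :=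
          Finset.sum_le_sum fun x _ => by omega
      _ = _ := by simp [Finset.sum_add_distrib, mul_comm]
  have h2 := sum_column_sub_pow_le ht hA
  set S := ∑ x, ((A.column x).card + 1 - t)
  have ht0 : (t : ℝ) ≠ 0 := by positivity
  have hn0 : (0 : ℝ) < n := by exact_mod_cast hn
  have h3 : (S : ℝ) ≤
      (P.ex n : ℝ) ^ (1 / (t : ℝ)) * (n : ℝ) ^ ((d : ℝ) + 1 - (d : ℝ) / (t : ℝ)) := by
    refine le_of_pow_le_pow_left₀ (n := t) (by omega) (by positivity) ?_
    have h4 : (S : ℝ) ^ t ≤ ((n : ℝ) ^ d) ^ (t - 1) * ((n : ℝ) ^ t * P.ex n) := by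
      exact_mod_cast h2
    refine h4.trans_eq ?_
    rw [mul_pow, ← Real.rpow_natCast (_ ^ (1 / (t : ℝ))), ← Real.rpow_mul (by positivity),
      one_div_mul_cancel ht0, Real.rpow_one, ← Real.rpow_natCast (_ ^ (_ : ℝ)),
      ← Real.rpow_mul (by positivity), ← pow_mul, ← mul_assoc, ← pow_add, mul_comm,
      ← Real.rpow_natCast]
    congr 2
    push_cast [Nat.cast_sub ht]
    field_simp
    ring
  rw [Real.rpow_natCast]
  have : (A.ones : ℝ) ≤ S + t * (n : ℝ) ^ d := by exact_mod_cast h1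
  linarith

theorem ex_stack_le {d n : ℕ} (hn : 0 < n) {k : Fin d → ℕ} (P : ZeroOneMatrix k) {t : ℕ}
    (ht : 1 ≤ t) :
    ((P.stack t).ex n : ℝ) ≤
      (P.ex n : ℝ) ^ (1 / (t : ℝ)) * (n : ℝ) ^ ((d : ℝ) + 1 - (d : ℝ) / (t : ℝ)) +
        t * (n : ℝ) ^ (d : ℝ) :=
  ex_le_of_forall (by positivity) fun _ hA => ones_le_of_not_contains_stack hn ht hA

/-! ### Lower bounds and asymptotics -/

/-- A matrix with two ones that differ in some coordinate is avoided by a full slice. -/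
theorem pow_le_ex {d n : ℕ} (hn : 0 < n) {k : Fin (d + 1) → ℕ} {P : ZeroOneMatrix k}
    (hP : 2 ≤ P.ones) : n ^ d ≤ P.ex n := by
  classical
  obtain ⟨x, hx, y, hy, hxy⟩ := Finset.one_lt_card.1 hP
  obtain ⟨i, hi⟩ := Function.ne_iff.1 hxy
  simp only [Finset.mem_filter, Finset.mem_univ, true_and] at hx hy
  refine le_trans ?_ (ones_le_ex
    (A := ofPred (k := fun _ : Fin (d + 1) => n) fun z => z i = ⟨0, hn⟩) ?_)
  · rw [ones]
    calc n ^ d = (Finset.univ : Finset (Fin d → Fin n)).card := by simp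
      _ ≤ _ := Finset.card_le_card_of_injOn (fun w => i.insertNth (α := fun _ => Fin n) ⟨0, hn⟩ w)
        (fun w _ => by simp) fun w _ w' _ h => (Fin.insertNth_inj.1 h).2
  · rintro ⟨f, hf⟩
    have h1 := hf x hx
    have h2 := hf y hy
    rw [submatrix, ofPred_eq_one] at h1 h2
    exact hi ((f i).injective (h1.trans h2.symm))

/-- Every one of `P` is repeated at all `s` heights, so a copy of the stack would relate `s`
distinct values of coordinate `i` to `s` distinct heights. -/
theorem mul_card_le_ex_stack {d n s : ℕ} {k : Fin (d + 1) → ℕ} {P : ZeroOneMatrix k}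
    {i : Fin (d + 1)} {x : Fin s → ∀ i, Fin (k i)} (hx : ∀ a, P (x a) = 1)
    (hxi : Function.Injective fun a => x a i) {E : Finset (Fin n × Fin n)}
    (hE : BicliqueFree s fun a b => (a, b) ∈ E) :
    n ^ d * E.card ≤ (P.stack s).ex n := by
  classical
  refine le_trans ?_ (ones_le_ex
    (A := ofPred (k := fun _ : Fin (d + 2) => n) fun z => (z i.castSucc, z (Fin.last _)) ∈ E) ?_)
  · rw [ones]
    calc n ^ d * E.card = (E ×ˢ (Finset.univ : Finset (Fin d → Fin n))).card := by
          simp [mul_comm]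
      _ ≤ _ := Finset.card_le_card_of_injOn
        (fun w => Fin.snoc (α := fun _ => Fin n) (i.insertNth (α := fun _ => Fin n) w.1.1 w.2) w.1.2)
        (fun w hw => by simpa using hw) fun w _ w' _ h => by
          rw [Fin.snoc_inj, Fin.insertNth_inj] at h
          exact Prod.ext (Prod.ext h.1.1 h.2) h.1.2
  · rintro ⟨f, hf⟩
    let c (j : Fin (d + 1)) := Fin.snoc_castSucc (α := fun _ => ℕ) s k j
    let l := Fin.snoc_last (α := fun _ => ℕ) s k
    refine hE (fun a => f i.castSucc (Fin.cast (c i).symm (x a i)))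
      (fun b => f (Fin.last _) (Fin.cast l.symm b)) ?_ ?_ fun a b => ?_
    · exact (f i.castSucc).injective.comp ((Fin.cast_injective _).comp hxi)
    · exact (f (Fin.last _)).injective.comp (Fin.cast_injective _)
    · let z : ∀ j, Fin (Fin.snoc (α := fun _ => ℕ) k s j) :=
        Fin.lastCases (Fin.cast l.symm b) fun j => Fin.cast (c j).symm (x a j)
      have hz : P.stack s z = 1 := by
        rw [stack, ← hx a]
        congr 1
        funext j
        simp [z]
      have := hf z hz
      rw [submatrix, ofPred_eq_one] at this
      simpa [z] using this

theorem ex_stack_isBigO {d : ℕ} {k : Fin (d + 1) → ℕ} {P : ZeroOneMatrix k} (hP : 2 ≤ P.ones)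
    {t : ℕ} (ht : 1 ≤ t) :
    (fun n : ℕ => ((P.stack t).ex n : ℝ)) =O[atTop] fun n : ℕ =>
      (P.ex n : ℝ) ^ (1 / (t : ℝ)) *
        (n : ℝ) ^ (((d + 1 : ℕ) : ℝ) + 1 - ((d + 1 : ℕ) : ℝ) / (t : ℝ)) := by
  refine IsBigO.of_bound (1 + t) ?_
  filter_upwards [eventually_ge_atTop 1] with n hn
  have hn1 : (1 : ℝ) ≤ n := by exact_mod_cast hn
  have ht1 : (1 : ℝ) ≤ t := by exact_mod_cast ht
  have hp : (n : ℝ) ^ (d : ℝ) ≤ P.ex n := by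
    rw [Real.rpow_natCast]
    exact_mod_cast pow_le_ex hn hP
  -- The slice bound `pow_le_ex` lets the main term absorb the truncation error; this is where two
  -- ones are needed.
  have h1 : (n : ℝ) ^ ((d + 1 : ℕ) : ℝ) ≤ (P.ex n : ℝ) ^ (1 / (t : ℝ)) *
        (n : ℝ) ^ (((d + 1 : ℕ) : ℝ) + 1 - ((d + 1 : ℕ) : ℝ) / (t : ℝ)) := by
    calc (n : ℝ) ^ ((d + 1 : ℕ) : ℝ) ≤ ((n : ℝ) ^ (d : ℝ)) ^ (1 / (t : ℝ)) *
        (n : ℝ) ^ (((d + 1 : ℕ) : ℝ) + 1 - ((d + 1 : ℕ) : ℝ) / (t : ℝ)) := by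
          rw [← Real.rpow_mul (by positivity), ← Real.rpow_add (by positivity)]
          refine Real.rpow_le_rpow_of_exponent_le hn1 ?_
          have : 1 / (t : ℝ) ≤ 1 := (div_le_one (by positivity)).2 ht1
          push_cast
          rw [add_div]
          linarith [mul_one_div (d : ℝ) t]
      _ ≤ _ := by gcongr
  have h2 := ex_stack_le hn P ht
  rw [Real.norm_of_nonneg (by positivity), Real.norm_of_nonneg (by positivity)]
  nlinarith

theorem ex_stack_isBigO_of_ex_isBigO {d : ℕ} {k : Fin d → ℕ} {P : ZeroOneMatrix k}
    (hP : (fun n : ℕ => (P.ex n : ℝ)) =O[atTop] fun n : ℕ => (n : ℝ) ^ ((d : ℝ) - 1))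
    {t : ℕ} (ht : 1 ≤ t) :
    (fun n : ℕ => ((P.stack t).ex n : ℝ)) =O[atTop]
      fun n : ℕ => (n : ℝ) ^ ((d : ℝ) + 1 - 1 / (t : ℝ)) := by
  obtain ⟨C, hC0, hC⟩ := hP.exists_nonneg
  refine IsBigO.of_bound (C ^ (1 / (t : ℝ)) + t) ?_
  filter_upwards [eventually_ge_atTop 1, hC.bound] with n hn hb
  have hn1 : (1 : ℝ) ≤ n := by exact_mod_cast hn
  have ht1 : (1 : ℝ) ≤ t := by exact_mod_cast ht
  rw [Real.norm_of_nonneg (by positivity), Real.norm_of_nonneg (by positivity)] at hb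
  rw [Real.norm_of_nonneg (by positivity), Real.norm_of_nonneg (by positivity)]
  refine (ex_stack_le hn P ht).trans ?_
  rw [add_mul]
  refine add_le_add ?_ ?_
  · calc (P.ex n : ℝ) ^ (1 / (t : ℝ)) * (n : ℝ) ^ ((d : ℝ) + 1 - (d : ℝ) / (t : ℝ))
        ≤ (C * (n : ℝ) ^ ((d : ℝ) - 1)) ^ (1 / (t : ℝ)) *
            (n : ℝ) ^ ((d : ℝ) + 1 - (d : ℝ) / (t : ℝ)) := by gcongr
      _ = C ^ (1 / (t : ℝ)) * (n : ℝ) ^ ((d : ℝ) + 1 - 1 / (t : ℝ)) := by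
        rw [Real.mul_rpow hC0 (by positivity), ← Real.rpow_mul (by positivity), mul_assoc,
          ← Real.rpow_add (by positivity)]
        congr 2
        field_simp
        ring
  · refine mul_le_mul_of_nonneg_left (Real.rpow_le_rpow_of_exponent_le hn1 ?_) (by positivity)
    have : 1 / (t : ℝ) ≤ 1 := (div_le_one (by positivity)).2 ht1
    linarith

theorem isBigO_ex_stack {d s : ℕ} {k : Fin (d + 1) → ℕ} {P : ZeroOneMatrix k}
    {i : Fin (d + 1)} {x : Fin s → ∀ i, Fin (k i)} (hx : ∀ a, P (x a) = 1)
    (hxi : Function.Injective fun a => x a i) {r C : ℝ} {N : ℕ}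
    (h : ∀ n, N ≤ n → ∃ E : Finset (Fin n × Fin n), (n : ℝ) ^ r ≤ C * E.card ∧
      BicliqueFree s fun a b => (a, b) ∈ E) (hC : 0 ≤ C) :
    (fun n : ℕ => (n : ℝ) ^ ((d : ℝ) + r)) =O[atTop] fun n : ℕ => ((P.stack s).ex n : ℝ) := by
  refine IsBigO.of_bound C ?_
  filter_upwards [eventually_ge_atTop (max N 1)] with n hn
  have hn1 : (0 : ℝ) < n := by exact_mod_cast (le_max_right N 1).trans hn
  obtain ⟨E, hE, hfree⟩ := h n ((le_max_left N 1).trans hn)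
  have h1 : (n : ℝ) ^ d * E.card ≤ (P.stack s).ex n := by
    exact_mod_cast mul_card_le_ex_stack hx hxi hfree
  rw [Real.norm_of_nonneg (by positivity), Real.norm_of_nonneg (by positivity),
    Real.rpow_add hn1, Real.rpow_natCast]
  calc (n : ℝ) ^ d * (n : ℝ) ^ r ≤ (n : ℝ) ^ d * (C * E.card) := by gcongr
    _ = C * ((n : ℝ) ^ d * E.card) := by ring
    _ ≤ _ := by gcongr

end ZeroOneMatrix

open ZeroOneMatrix in
theorem mainTheorem3 {d : ℕ} (hd : 0 < d) {k : Fin d → ℕ} (P : ZeroOneMatrix k) :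
    (2 ≤ P.ones → ∀ t : ℕ, 1 ≤ t →
      (fun n : ℕ => ((P.stack t).ex n : ℝ)) =O[atTop]
        fun n : ℕ => (P.ex n : ℝ) ^ (1 / (t : ℝ)) * (n : ℝ) ^ ((d : ℝ) + 1 - (d : ℝ) / (t : ℝ))) ∧
    ((fun n : ℕ => (P.ex n : ℝ)) =O[atTop] (fun n : ℕ => (n : ℝ) ^ ((d : ℝ) - 1)) →
      (∀ t : ℕ, 1 ≤ t →
        (fun n : ℕ => ((P.stack t).ex n : ℝ)) =O[atTop]
          fun n : ℕ => (n : ℝ) ^ ((d : ℝ) + 1 - 1 / (t : ℝ))) ∧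
      (2 ≤ P.ones →
        (fun n : ℕ => ((P.stack 2).ex n : ℝ)) =Θ[atTop]
          fun n : ℕ => (n : ℝ) ^ ((d : ℝ) + 1 / 2)) ∧
      ((∃ x y z : ∀ i, Fin (k i), P x = 1 ∧ P y = 1 ∧ P z = 1 ∧
          x ⟨0, hd⟩ ≠ y ⟨0, hd⟩ ∧ x ⟨0, hd⟩ ≠ z ⟨0, hd⟩ ∧ y ⟨0, hd⟩ ≠ z ⟨0, hd⟩) →
        (fun n : ℕ => ((P.stack 3).ex n : ℝ)) =Θ[atTop]
          fun n : ℕ => (n : ℝ) ^ ((d : ℝ) + 2 / 3))) := by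
  
  obtain ⟨d, rfl⟩ := Nat.exists_eq_add_of_le' (Nat.one_le_iff_ne_zero.2 hd.ne')
  refine ⟨fun hP t ht => ex_stack_isBigO hP ht, fun hO =>
    ⟨fun t ht => ex_stack_isBigO_of_ex_isBigO hO ht, fun hP => ⟨?_, ?_⟩, ?_⟩⟩
  · convert ex_stack_isBigO_of_ex_isBigO hO one_le_two using 3
    norm_num
    ring
  · obtain ⟨x, hx, y, hy, hxy⟩ := Finset.one_lt_card.1 hP
    obtain ⟨i, hi⟩ := Function.ne_iff.1 hxy
    simp only [Finset.mem_filter, Finset.mem_univ, true_and] at hx hy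
    have := isBigO_ex_stack (P := P) (i := i) (x := ![x, y]) (by simp [Fin.forall_fin_two, hx, hy])
      (injective_fin_two hi) (fun n hn => exists_bicliqueFree_two hn) (by norm_num)
    convert this using 3
    push_cast
    ring
  · rintro ⟨x, y, z, hx, hy, hz, hxy, hxz, hyz⟩
    constructor
    · convert ex_stack_isBigO_of_ex_isBigO hO (t := 3) (by norm_num) using 3
      norm_num
      ring
    · have := isBigO_ex_stack (P := P) (i := ⟨0, hd⟩) (x := ![x, y, z])
        (by simp [Fin.forall_fin_succ, hx, hy, hz])
        (injective_fin_three hxy hxz hyz) (fun n hn => exists_bicliqueFree_three hn) (by norm_num)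
      convert this using 3
      push_cast
      ring
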